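/- Let $n$ be a natural number and $[n]=\{1,\dots,n\}$. For $k,l\in[n]$ let $C_{kl}(0)$ be the $n\times n$ matrix with entries in $[0,\infty]$ that has $0$'s on the diagonal and at the positions $(k,l)$ and $(l,k)$, and $\infty$ everywhere else. Multiply matrices tropically, that is, $(A\odot B)_{ij}=\min_{h}(A_{ih}+B_{hj})$. Call a tropical product $A_1\odot\cdots\odot A_m$ irredundant if leaving out any one of its factors changes the value of the product. Then, in the monoid generated by the matrices $C_{kl}(0)$, $k,l\in[n]$, every irredundant product $A_1\odot\cdots\odot A_m$ in which each factor is one of the matrices $C_{kl}(0)$ has at most $\binom{n}{2}$ factors. -/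

import Mathlib

open scoped ENNReal

noncomputable section

namespace LossyGossip

/-- Square `n × n` matrices with entries in `[0, ∞]`, regarded as elements of the tropical
(min-plus) semiring: in `Tropical ℝ≥0∞` addition is `min` and multiplication is `+`, so the
multiplication of these matrices is the tropical matrix product and `1` is the tropical
identity matrix (`0` on the diagonal and `∞` elsewhere). -/
abbrev TropMatrix (n : ℕ) : Type := Matrix (Fin n) (Fin n) (Tropical ℝ≥0∞)

/-- The phone call matrix `C_{kl}(a)`: zeroes on the diagonal and `∞` everywhere else, except for
the value `a` on the positions `(k, l)` and `(l, k)`. (For `k = l` and `a = 0` this is the tropical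
identity matrix.) -/
def phoneCall {n : ℕ} (k l : Fin n) (a : ℝ≥0∞) : TropMatrix n :=
  Matrix.of fun i j =>
    if i = j then Tropical.trop 0
    else if (i = k ∧ j = l) ∨ (i = l ∧ j = k) then Tropical.trop a
    else Tropical.trop ∞

/-- The monoid generated, under tropical matrix multiplication, by the ordinary gossip matrices
`C_{kl}(0)`, with `k, l ∈ [n]`. -/
def ordinaryGossipMonoid (n : ℕ) : Submonoid (TropMatrix n) :=
  Submonoid.closure {A | ∃ k l : Fin n, A = phoneCall k l 0}

/-- A product `x₁ ⋯ x_m` in a monoid, given by the list of its factors, is irredundant if leaving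
out any one of its factors changes the value of the product. -/
def IrredundantProduct {M : Type*} [Monoid M] (L : List M) : Prop :=
  ∀ i : ℕ, i < L.length → (L.eraseIdx i).prod ≠ L.prod

end LossyGossip

end

open Matrix

namespace LossyGossip

variable {n : ℕ}

/-! In an irredundant product every factor changes the product of the factors before it, so it
suffices to bound sequences of calls with that property. Each call is modelled by a generic rotation
in the `(k, l)`-plane: the product `g` of these rotations is a real matrix with the zero pattern of
the gossip matrix. Alongside `g` grows a space `V` of skew-symmetric matrices, the tangent
directions that keep the zeros of `g`. Every call that changes the product raises `dim V` by one
(`IsTangentModel.exists_mul_phoneCall`), and skew-symmetric matrices have dimension `n.choose 2`. -/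

theorem mul_phoneCall_apply (P : TropMatrix n) {k l : Fin n} (hkl : k ≠ l) (p q : Fin n) :
    (P * phoneCall k l 0) p q = if q = k ∨ q = l then P p k + P p l else P p q := by
  have key : ∀ h, P p h * phoneCall k l 0 h q =
      if h = q ∨ (h = k ∧ q = l) ∨ (h = l ∧ q = k) then P p h else 0 := by
    intro h
    have h1 : (Tropical.trop 0 : Tropical ℝ≥0∞) = 1 := rfl
    have h0 : (Tropical.trop ∞ : Tropical ℝ≥0∞) = 0 := rfl
    simp only [phoneCall, Matrix.of_apply, h1, h0]
    by_cases a : h = q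
    · simp [a]
    · by_cases b : (h = k ∧ q = l) ∨ (h = l ∧ q = k)
      · simp only [a, b, if_false, if_true, or_true, mul_one]
      · simp only [a, b, if_false, or_false, mul_zero]
  rw [Matrix.mul_apply, Finset.sum_congr rfl fun h _ => key h, ← Finset.sum_filter]
  split_ifs with hq
  · rw [← Finset.sum_pair hkl]
    congr 1
    ext h
    simp only [Finset.mem_filter, Finset.mem_univ, true_and, Finset.mem_insert,
      Finset.mem_singleton]
    grind
  · have : Finset.univ.filter (fun h => h = q ∨ (h = k ∧ q = l) ∨ (h = l ∧ q = k)) = {q} := by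
      ext h
      simp only [Finset.mem_filter, Finset.mem_univ, true_and, Finset.mem_singleton]
      grind
    rw [this, Finset.sum_singleton]

theorem phoneCall_self (k : Fin n) : phoneCall k k 0 = (1 : TropMatrix n) := by
  ext i j
  have h1 : (Tropical.trop 0 : Tropical ℝ≥0∞) = 1 := rfl
  have h0 : (Tropical.trop ∞ : Tropical ℝ≥0∞) = 0 := rfl
  simp only [phoneCall, Matrix.of_apply, h1, h0, Matrix.one_apply]
  grind

/-- The real skew-symmetric matrices. -/
def skewMatrices (n : ℕ) : Submodule ℝ (Matrix (Fin n) (Fin n) ℝ) where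
  carrier := {Y | Yᵀ = -Y}
  add_mem' {A B} hA hB := by
    simp only [Set.mem_ofPred_eq] at *
    rw [transpose_add, hA, hB, neg_add]
  zero_mem' := by simp
  smul_mem' c A hA := by
    simp only [Set.mem_ofPred_eq] at *
    rw [transpose_smul, hA, smul_neg]

theorem mem_skewMatrices {Y : Matrix (Fin n) (Fin n) ℝ} : Y ∈ skewMatrices n ↔ Yᵀ = -Y :=
  Iff.rfl

theorem finrank_skewMatrices_le (n : ℕ) : Module.finrank ℝ (skewMatrices n) ≤ n.choose 2 := by
  let f : skewMatrices n →ₗ[ℝ] ((Σ j : Fin n, Fin j.val) → ℝ) :=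
    { toFun := fun Y x => Y.1 (x.2.castLE x.1.2.le) x.1
      map_add' := fun _ _ => rfl
      map_smul' := fun _ _ => rfl }
  have hf : Function.Injective f := by
    rw [injective_iff_map_eq_zero]
    rintro ⟨Y, hY⟩ h
    have hs : ∀ i j, Y j i = -Y i j := fun i j => congrFun₂ hY i j
    have hlt : ∀ i j : Fin n, i < j → Y i j = 0 := fun i j hij =>
      congrFun h ⟨j, ⟨i.val, hij⟩⟩
    ext i j
    rcases lt_trichotomy i j with hij | rfl | hij
    · exact hlt i j hij
    · have := hs i i
      change Y i i = 0
      linarith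
    · change Y i j = 0
      rw [hs j i, hlt j i hij, neg_zero]
  refine (LinearMap.finrank_le_finrank_of_injective hf).trans ?_
  rw [Module.finrank_fintype_fun_eq_card, Fintype.card_sigma]
  simp only [Fintype.card_fin]
  rw [Fin.sum_univ_eq_sum_range (fun i => i), Finset.sum_range_id, Nat.choose_two_right]

/-- The generator of the rotations in the `(k, l)`-plane. -/
def planeGenerator (k l : Fin n) : Matrix (Fin n) (Fin n) ℝ := single k l 1 - single l k 1

theorem planeGenerator_mem_skewMatrices (k l : Fin n) : planeGenerator k l ∈ skewMatrices n := by
  rw [mem_skewMatrices, planeGenerator, transpose_sub, transpose_single, transpose_single, neg_sub]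

theorem mul_planeGenerator_apply (g : Matrix (Fin n) (Fin n) ℝ) (k l p q : Fin n) :
    (g * planeGenerator k l) p q = (if q = l then g p k else 0) - if q = k then g p l else 0 := by
  rw [planeGenerator, Matrix.mul_sub, Matrix.sub_apply]
  congr 1 <;> split_ifs with h <;> simp [h]

/-- The matrix acting on the `(k, l)`-plane by `(c, s; -s, c)` and fixing the other coordinates. -/
def planeRotation (k l : Fin n) (c s : ℝ) : Matrix (Fin n) (Fin n) ℝ :=
  1 + (c - 1) • (single k k 1 + single l l 1) + s • planeGenerator k l

theorem planeRotation_mul_transpose {k l : Fin n} (hkl : k ≠ l) {c s : ℝ}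
    (hcs : c ^ 2 + s ^ 2 = 1) : planeRotation k l c s * (planeRotation k l c s)ᵀ = 1 := by
  have hlk := hkl.symm
  set D : Matrix (Fin n) (Fin n) ℝ := single k k 1 + single l l 1 with hD
  set X : Matrix (Fin n) (Fin n) ℝ := planeGenerator k l with hX
  have hDt : Dᵀ = D := by simp [hD]
  have hXt : Xᵀ = -X := planeGenerator_mem_skewMatrices k l
  have hDD : D * D = D := by
    simp [hD, Matrix.mul_add, Matrix.add_mul, hkl, hlk]
  have hDX : D * X = X := by
    simp [hD, hX, planeGenerator, Matrix.mul_sub, Matrix.add_mul, hkl, hlk]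
  have hXD : X * D = X := by
    simp [hD, hX, planeGenerator, Matrix.mul_add, Matrix.sub_mul, hkl, hlk]
    abel
  have hXX : X * X = -D := by
    simp [hD, hX, planeGenerator, Matrix.mul_sub, Matrix.sub_mul, hkl, hlk]
    abel
  have hR : planeRotation k l c s = 1 + (c - 1) • D + s • X := rfl
  rw [hR, transpose_add, transpose_add, transpose_one, transpose_smul, transpose_smul, hDt, hXt]
  simp only [Matrix.add_mul, Matrix.mul_add, Matrix.one_mul, Matrix.mul_one, Matrix.smul_mul,
    Matrix.mul_smul, Matrix.mul_neg, smul_neg, hDD, hDX, hXD, hXX]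
  match_scalars
  all_goals first | ring1 | linear_combination hcs

theorem mul_planeRotation_apply (h : Matrix (Fin n) (Fin n) ℝ) {k l : Fin n} (hkl : k ≠ l)
    (c s : ℝ) (p q : Fin n) :
    (h * planeRotation k l c s) p q =
      if q = k then c * h p k - s * h p l else if q = l then s * h p k + c * h p l else h p q := by
  have e1 : ∀ i : Fin n, (h * single i i (1 : ℝ)) p q = if q = i then h p i else 0 := by
    intro i
    split_ifs with hi <;> simp [hi]
  simp only [planeRotation, Matrix.mul_add, Matrix.mul_one, Matrix.mul_smul, Matrix.add_apply,
    Matrix.smul_apply, mul_planeGenerator_apply, e1, smul_eq_mul]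
  by_cases hk : q = k
  · subst hk
    simp [hkl]
    ring
  · by_cases hl : q = l
    · subst hl
      simp [hk]
      ring
    · simp [hk, hl]

/-- A rotation angle for which no nonzero vector among finitely many given vectors of the plane is
rotated onto a coordinate axis. -/
theorem exists_generic_rotation {ι : Type*} [Fintype ι] (a b : ι → ℝ) :
    ∃ c s : ℝ, c ^ 2 + s ^ 2 = 1 ∧ ∀ p, (a p ≠ 0 ∨ b p ≠ 0) →
      c * a p - s * b p ≠ 0 ∧ s * a p + c * b p ≠ 0 := by
  classical
  -- `u` is the tangent of the angle; the excluded values are those at which a rotated coordinate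
  -- vanishes. Zero denominators are treated separately below.
  obtain ⟨u, hu⟩ := Infinite.exists_notMem_finset
    (Finset.univ.image (fun p => a p / b p) ∪ Finset.univ.image (fun p => -b p / a p))
  simp only [Finset.mem_union, Finset.mem_image, Finset.mem_univ, true_and, not_or,
    not_exists] at hu
  obtain ⟨hu1, hu2⟩ := hu
  have hpos : 0 < 1 + u ^ 2 := by positivity
  have hr : (√(1 + u ^ 2))⁻¹ ≠ 0 := inv_ne_zero (Real.sqrt_ne_zero'.mpr hpos)
  refine ⟨(√(1 + u ^ 2))⁻¹, u * (√(1 + u ^ 2))⁻¹, ?_, fun p hp => ⟨fun h => ?_, fun h => ?_⟩⟩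
  · rw [mul_pow, inv_pow, Real.sq_sqrt hpos.le]
    field_simp
  · have h' : a p - u * b p = 0 := by
      refine (mul_eq_zero.mp ?_).resolve_left hr
      linear_combination h
    by_cases hb : b p = 0
    · simp [hb] at h' hp
      exact hp h'
    · exact hu1 p (by rw [div_eq_iff hb]; linarith)
  · have h' : u * a p + b p = 0 := by
      refine (mul_eq_zero.mp ?_).resolve_left hr
      linear_combination h
    by_cases ha : a p = 0
    · simp [ha] at h' hp
      exact hp h'
    · exact hu2 p (by rw [div_eq_iff ha]; linarith)

/-- `g` is a real matrix with the zero pattern of the gossip matrix `P`, and `V` is a space of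
skew-symmetric matrices such that all of `g * V` is supported in the support of `g`. -/
structure IsTangentModel (P : TropMatrix n) (g : Matrix (Fin n) (Fin n) ℝ)
    (V : Submodule ℝ (Matrix (Fin n) (Fin n) ℝ)) : Prop where
  -- In `Tropical ℝ≥0∞`, `0` is the entry `∞` and `1` is the entry `0`.
  pattern : ∀ p q, P p q = if g p q = 0 then 0 else 1
  le_skew : V ≤ skewMatrices n
  support : ∀ Y ∈ V, ∀ p q, g p q = 0 → (g * Y) p q = 0

theorem isTangentModel_one : IsTangentModel (1 : TropMatrix n) 1 ⊥ where
  pattern p q := by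
    by_cases h : p = q <;> simp [Matrix.one_apply, h]
  le_skew := bot_le
  support Y hY p q _ := by
    rw [(Submodule.mem_bot ℝ).mp hY, Matrix.mul_zero, Matrix.zero_apply]

/-- The generator of a call in which somebody learns something is a new tangent direction. -/
theorem IsTangentModel.planeGenerator_notMem {P : TropMatrix n} {g V} (H : IsTangentModel P g V)
    {k l : Fin n} (hkl : k ≠ l) (hne : P * phoneCall k l 0 ≠ P) : planeGenerator k l ∉ V := by
  intro hX
  apply hne
  -- Up to sign, multiplying `g` by the generator swaps columns `k` and `l` of `g`, so membership in
  -- `V` forces these columns to have the same zeros.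
  have hiff : ∀ p, g p k = 0 ↔ g p l = 0 := fun p => by
    constructor
    · intro h0
      simpa [mul_planeGenerator_apply, hkl] using H.support _ hX p k h0
    · intro h0
      simpa [mul_planeGenerator_apply, hkl.symm] using H.support _ hX p l h0
  ext p q
  rw [mul_phoneCall_apply P hkl]
  have hPkl : P p k = P p l := by simp only [H.pattern, hiff p]
  split_ifs with hq
  · rcases hq with rfl | rfl
    · rw [hPkl, Tropical.add_self]
    · rw [hPkl, Tropical.add_self]
  · rfl

/-- Adjoin the generator to `V`, conjugate by the rotation `R`, and replace `g` by `g * R`. Since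
`(g * R) * (Rᵀ * Y * R) = (g * Y) * R`, the support condition reduces to the old one. -/
theorem IsTangentModel.exists_mul_phoneCall {P : TropMatrix n} {g V} (H : IsTangentModel P g V)
    {k l : Fin n} (hne : P * phoneCall k l 0 ≠ P) :
    ∃ g' V', IsTangentModel (P * phoneCall k l 0) g' V' ∧
      Module.finrank ℝ V' = Module.finrank ℝ V + 1 := by
  have hkl : k ≠ l := by
    rintro rfl
    exact hne (by rw [phoneCall_self, mul_one])
  have hX := H.planeGenerator_notMem hkl hne
  obtain ⟨c, s, hcs, hgen⟩ := exists_generic_rotation (fun p => g p k) (fun p => g p l)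
  set R := planeRotation k l c s with hRdef
  have hR : R * Rᵀ = 1 := planeRotation_mul_transpose hkl hcs
  let Φ : Matrix (Fin n) (Fin n) ℝ →ₗ[ℝ] Matrix (Fin n) (Fin n) ℝ :=
    LinearMap.mulLeft ℝ Rᵀ ∘ₗ LinearMap.mulRight ℝ R
  have hΦ : ∀ Y, Φ Y = Rᵀ * (Y * R) := fun _ => rfl
  have hΦi : Function.Injective Φ := fun Y Z h => by
    have h2 : R * (Rᵀ * (Y * R)) * Rᵀ = R * (Rᵀ * (Z * R)) * Rᵀ := by
      rw [← hΦ, ← hΦ, h]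
    rwa [← Matrix.mul_assoc R, ← Matrix.mul_assoc R, hR, Matrix.one_mul, Matrix.one_mul,
      Matrix.mul_assoc, Matrix.mul_assoc, hR, Matrix.mul_one, Matrix.mul_one] at h2
  have hmul : ∀ Y, g * R * Φ Y = g * Y * R := fun Y => by
    rw [hΦ, Matrix.mul_assoc g R, ← Matrix.mul_assoc R, hR, Matrix.one_mul, ← Matrix.mul_assoc]
  -- Genericity of the angle: no cancellation, so the new support in columns `k`, `l` is the union
  -- of the old ones.
  have hzero : ∀ p, ((g * R) p k = 0 ∨ (g * R) p l = 0) → g p k = 0 ∧ g p l = 0 := by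
    intro p hp
    by_contra hcon
    have := hgen p (not_and_or.mp hcon)
    simp only [hRdef, mul_planeRotation_apply g hkl, if_true, hkl.symm, if_false] at hp
    tauto
  have hrow : ∀ p q, q ≠ k → q ≠ l → ∀ h : Matrix (Fin n) (Fin n) ℝ, (h * R) p q = h p q := by
    intro p q hk hl h
    rw [hRdef, mul_planeRotation_apply h hkl, if_neg hk, if_neg hl]
  refine ⟨g * R, (V ⊔ ℝ ∙ planeGenerator k l).map Φ, ⟨fun p q => ?_, ?_, ?_⟩, ?_⟩
  · rw [mul_phoneCall_apply P hkl]
    split_ifs with hq h0 h0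
    · have := hzero p (by rcases hq with rfl | rfl <;> simp [h0])
      simp [H.pattern, this]
    · rw [hRdef, mul_planeRotation_apply g hkl] at h0
      by_cases h1 : g p k = 0
      · by_cases h2 : g p l = 0
        · rcases hq with rfl | rfl <;> simp [h1, h2] at h0
        · simp [H.pattern, h1, h2]
      · by_cases h2 : g p l = 0 <;> simp [H.pattern, h1, h2]
    · push Not at hq
      rw [hrow p q hq.1 hq.2] at h0
      simp [H.pattern, h0]
    · push Not at hq
      rw [hrow p q hq.1 hq.2] at h0
      simp [H.pattern, h0]
  · rw [Submodule.map_le_iff_le_comap]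
    have hle : V ⊔ ℝ ∙ planeGenerator k l ≤ skewMatrices n :=
      sup_le H.le_skew ((Submodule.span_singleton_le_iff_mem _ _).mpr
        (planeGenerator_mem_skewMatrices k l))
    intro Y hY
    have hYs : Yᵀ = -Y := hle hY
    rw [Submodule.mem_comap, mem_skewMatrices, hΦ, transpose_mul, transpose_mul,
      transpose_transpose, hYs, Matrix.mul_neg, Matrix.neg_mul, Matrix.mul_assoc]
  · rintro _ ⟨Y, hY, rfl⟩ p q h0
    rw [hmul]
    obtain ⟨Z, hZ, W, hW, rfl⟩ := Submodule.mem_sup.mp hY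
    obtain ⟨r, rfl⟩ := Submodule.mem_span_singleton.mp hW
    by_cases hq : q = k ∨ q = l
    · obtain ⟨h1, h2⟩ := hzero p (by rcases hq with rfl | rfl <;> simp [h0])
      have hk : (g * (Z + r • planeGenerator k l)) p k = 0 := by
        simp [Matrix.mul_add, H.support Z hZ p k h1, mul_planeGenerator_apply, h1, h2]
      have hl : (g * (Z + r • planeGenerator k l)) p l = 0 := by
        simp [Matrix.mul_add, H.support Z hZ p l h2, mul_planeGenerator_apply, h1, h2]
      rw [hRdef, mul_planeRotation_apply _ hkl, hk, hl]
      rcases hq with rfl | rfl <;> simp [hkl.symm]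
    · push Not at hq
      rw [hrow p q hq.1 hq.2] at h0 ⊢
      simp [Matrix.mul_add, H.support Z hZ p q h0, mul_planeGenerator_apply, hq.1, hq.2]
  · rw [← (Submodule.equivMapOfInjective Φ hΦi _).finrank_eq]
    exact Submodule.finrank_sup_span_singleton hX

theorem exists_isTangentModel_prod (L : List (TropMatrix n))
    (hL : ∀ A ∈ L, ∃ k l : Fin n, A = phoneCall k l 0)
    (hne : ∀ i < L.length, (L.take (i + 1)).prod ≠ (L.take i).prod) :
    ∃ g V, IsTangentModel L.prod g V ∧ Module.finrank ℝ V = L.length := by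
  induction L using List.reverseRecOn with
  | nil => exact ⟨1, ⊥, isTangentModel_one, by simp⟩
  | append_singleton L A ih =>
    obtain ⟨g, V, H, hV⟩ := ih (fun B hB => hL B (by simp [hB])) (fun i hi => by
      have := hne i (by simp; omega)
      rwa [List.take_append_of_le_length (by omega), List.take_append_of_le_length (by omega)]
        at this)
    obtain ⟨k, l, rfl⟩ := hL A (by simp)
    have hlast : L.prod * phoneCall k l 0 ≠ L.prod := by
      have := hne L.length (by simp)
      rwa [List.take_left, List.take_of_length_le (by simp), List.prod_append,
        List.prod_singleton] at this
    obtain ⟨g', V', H', hV'⟩ := H.exists_mul_phoneCall hlast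
    refine ⟨g', V', ?_, ?_⟩
    · rwa [List.prod_append, List.prod_singleton]
    · rw [hV', hV, List.length_append, List.length_singleton]

/-- A sequence of calls in each of which somebody learns something new has at most `n.choose 2`
members. -/
theorem length_le_choose_two (L : List (TropMatrix n))
    (hL : ∀ A ∈ L, ∃ k l : Fin n, A = phoneCall k l 0)
    (hne : ∀ i < L.length, (L.take (i + 1)).prod ≠ (L.take i).prod) :
    L.length ≤ n.choose 2 := by
  obtain ⟨g, V, H, hV⟩ := exists_isTangentModel_prod L hL hne
  rw [← hV]
  exact (Submodule.finrank_mono H.le_skew).trans (finrank_skewMatrices_le n)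

/-- A factor that leaves the prefix product unchanged could be erased. -/
theorem IrredundantProduct.prod_take_succ_ne {M : Type*} [Monoid M] {L : List M}
    (h : IrredundantProduct L) {i : ℕ} (hi : i < L.length) :
    (L.take (i + 1)).prod ≠ (L.take i).prod := fun he => h i hi <| by
  rw [List.eraseIdx_eq_take_drop_succ, List.prod_append, ← he, List.prod_take_mul_prod_drop]

end LossyGossip

theorem corollary1p5 (n : ℕ) (L : List (LossyGossip.ordinaryGossipMonoid n))
    (hL : ∀ A ∈ L, ∃ k l : Fin n,
      (A : LossyGossip.TropMatrix n) = LossyGossip.phoneCall k l 0)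
    (hirr : LossyGossip.IrredundantProduct L) :
    L.length ≤ n.choose 2 := by
  have key := LossyGossip.length_le_choose_two
    (L.map (LossyGossip.ordinaryGossipMonoid n).subtype) ?_ ?_
  · rwa [List.length_map] at key
  · intro A hA
    obtain ⟨B, hB, rfl⟩ := List.mem_map.mp hA
    exact hL B hB
  · intro i hi he
    rw [List.length_map] at hi
    rw [← List.map_take, ← List.map_take, ← map_list_prod, ← map_list_prod] at he
    exact hirr.prod_take_succ_ne hi (Subtype.coe_injective he)
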